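/- Let $\mathcal V$ be a finite set of time series; the series $X$ takes values in a countable (discrete) set $S_X$, and $X_t$ denotes its value at time $t\in\mathbb Z$. Fix a maximal lag $\gamma_{\max}\in\mathbb N$. **Graphs.** A full-time causal graph (FTCG) is an acyclic directed graph on the vertices $X_t$ ($X\in\mathcal V$, $t\in\mathbb Z$) whose edges $X_s\to Y_t$ satisfy $0\le t-s\le\gamma_{\max}$ and are invariant under time shifts. Its summary causal graph (SCG) is the directed graph on $\mathcal V$ with $X\to Y$ iff $X_{t-k}\to Y_t$ for some $0\le k\le\gamma_{\max}$. Its extended summary causal graph (ESCG) is the directed graph with two vertices $X_{t^-},X_t$ for each $X\in\mathcal V$, with $X_t\to Y_t$ iff this edge is in the FTCG, $X_{t^-}\to Y_t$ iff $X_{t-k}\to Y_t$ is in the FTCG for some $0<k\le\gamma_{\max}$, and no other edges. The candidate FTCGs of an ESCG or SCG $\mathcal G$ are the FTCGs from which $\mathcal G$ is derived; $\mathcal C(\mathcal G)$ is the set of them. A path between two vertices of an FTCG is a finite sequence of distinct vertices from one to the other in which successive vertices are adjacent; a backdoor path between $u$ and $v$ is one whose first edge points into $u$. A vertex $b$ with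 neighbours $a,c$ on a path is a collider if $a\to b\leftarrow c$, and a non-collider otherwise. A path between $u$ and $v$ is active given $\mathcal Z$ if $u,v\notin\mathcal Z$, no non-collider on it is in $\mathcal Z$, and every collider on it has a descendant in $\mathcal Z$; otherwise $\mathcal Z$ blocks it. A vertex is a descendant of itself. A set $\mathcal Z$ satisfies the backdoor criterion over all candidate FTCGs relative to $(X_{t-\gamma},Y_t)$ if in every FTCG in $\mathcal C(\mathcal G)$ it blocks all backdoor paths between $X_{t-\gamma}$ and $Y_t$ and contains no descendant of $X_{t-\gamma}$. **Models.** A dynamic structural causal model (DSCM) with FTCG $\mathcal G^f$ consists of jointly independent noises $U_{X,t}$, measurable structural functions $f_X$ that do not depend on time, and variables $X_t$, such that $X_t=f_X(\text{parents of }X_t\text{ in }\mathcal G^f,\,U_{X,t})$ for all $X,t$, and each $X_t$ is a measurable function of the noises of its ancestors in $\mathcal G^f$ (itself included). Thus there is no hidden common cause (causal sufficiency), and causal relations are constant throughout time (consistency throughout time). Its law $P$ is the joint distribution of all $X_t$; $P$ is positive if any finitely many variables take any prescribed values with positive probability. The total effect $P(y_t\mid do(x_{t-\gamma}))$ is the probability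 of $Y_t=y_t$ after the structural equation of $X_{t-\gamma}$ has been replaced by $X_{t-\gamma}=x_{t-\gamma}$, the values before time $t-\gamma$, the noises and all other structural equations being kept. It is identifiable in $\mathcal G$ if there is a do-free formula, i.e. a function of the observed law alone, that gives the total effect (for all values $x_{t-\gamma},y_t$) in every DSCM with positive law whose FTCG is any element of $\mathcal C(\mathcal G)$. **Statement.** Let $\mathcal G$ be the ESCG or SCG derived from the FTCG of a DSCM with positive law $P$, let $t\in\mathbb Z$, $\gamma\ge 0$, and let $X_{t-\gamma}\neq Y_t$ be distinct vertices. If a finite set $\mathcal Z$ satisfies the backdoor criterion over all candidate FTCGs relative to $(X_{t-\gamma},Y_t)$, then the total effect of $X_{t-\gamma}$ on $Y_t$ is identifiable in $\mathcal G$, and $\mathcal Z$ is a valid adjustment set: for all values $x_{t-\gamma}$ and $y_t$, $$P(y_t\mid do(x_{t-\gamma}))=\sum_{\mathbf z}P(y_t\mid x_{t-\gamma},\mathbf z)\,P(\mathbf z).$$ -/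

import Mathlib

open MeasureTheory ProbabilityTheory

universe w

/-! ### Paths, blocking and descendants in a directed acyclic graph -/

namespace Digraph

variable {α : Type*} (G : Digraph α)

/-- `π` lists the vertices of a path from `x` to `y`: they are distinct, and successive ones are
adjacent, in either direction. -/
def IsPathBetween (π : List α) (x y : α) : Prop :=
  π.Nodup ∧ π.head? = some x ∧ π.getLast? = some y ∧
    π.IsChain (fun a b => G.Adj a b ∨ G.Adj b a)

/-- A backdoor path between `x` and `y`: a path whose first edge has an arrowhead into `x`. -/
def IsBackdoorPath (π : List α) (x y : α) : Prop :=
  G.IsPathBetween π x y ∧ ∃ w, [x, w] <+: π ∧ G.Adj w x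

/-- `b` is a collider on `π`: `a → b ← c` is a subpath of `π`. -/
def IsColliderOn (π : List α) (b : α) : Prop :=
  ∃ a c, [a, b, c] <:+: π ∧ G.Adj a b ∧ G.Adj c b

/-- `b` is an interior non-collider on `π`: it has neighbours `a`, `c` on `π`, and `a ← b` or
`b → c`. -/
def IsNonColliderOn (π : List α) (b : α) : Prop :=
  ∃ a c, [a, b, c] <:+: π ∧ (G.Adj b a ∨ G.Adj b c)

/-- `v` is a descendant of `u`; every vertex is its own descendant. -/
def IsDescendant (u v : α) : Prop := Relation.ReflTransGen G.Adj u v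

/-- The path `π` between `x` and `y` is active given `Z`. -/
def IsActive (Z : Set α) (π : List α) (x y : α) : Prop :=
  x ∉ Z ∧ y ∉ Z ∧ (∀ b, G.IsNonColliderOn π b → b ∉ Z) ∧
    ∀ b, G.IsColliderOn π b → ∃ d ∈ Z, G.IsDescendant b d

/-- `Z` blocks the path `π` between `x` and `y`. -/
def Blocks (Z : Set α) (π : List α) (x y : α) : Prop := ¬ G.IsActive Z π x y

end Digraph

/-! ### Full-time causal graphs and their abstractions -/

/-- A full-time causal graph over the time series `V` with maximal lag `γmax`: an acyclic directed
graph on the instances `(X, t)`, `t ∈ ℤ`, in which causes do not come after their effects and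
whose edges are constant throughout time. -/
structure FTCG (V : Type*) (γmax : ℕ) extends Digraph (V × ℤ) where
  le_of_adj : ∀ {u v : V × ℤ}, Adj u v → u.2 ≤ v.2
  lag_le : ∀ {u v : V × ℤ}, Adj u v → v.2 - u.2 ≤ γmax
  shift : ∀ (X Y : V) (s t k : ℤ), Adj (X, s) (Y, t) ↔ Adj (X, s + k) (Y, t + k)
  acyclic : ∀ u, ¬ Relation.TransGen Adj u u

/-- The vertices of an extended summary causal graph: `X_{t^-}` and `X_t` for every series `X`. -/
inductive ESCGVertex (V : Type*) where
  | past (X : V)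
  | present (X : V)

namespace FTCG

variable {V : Type*} {γmax : ℕ} (F : FTCG V γmax)

/-- `X_{t-k} → Y_t` (for one, equivalently for every, time `t`). -/
def LagAdj (X : V) (k : ℕ) (Y : V) : Prop := F.Adj (X, -(k : ℤ)) (Y, 0)

/-- The parents of `Y` in relative time: the pairs `(X, k)` with `X_{t-k} → Y_t`. -/
abbrev Pa (Y : V) : Type _ := {p : V × ℕ // F.LagAdj p.1 p.2 Y}

/-- The extended summary causal graph derived from `F`. -/
def escg : Digraph (ESCGVertex V) where
  Adj
    | .present X, .present Y => F.LagAdj X 0 Y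
    | .past X, .present Y => ∃ k : ℕ, 0 < k ∧ k ≤ γmax ∧ F.LagAdj X k Y
    | _, .past _ => False

/-- The summary causal graph derived from `F`. -/
def scg : Digraph V where
  Adj X Y := ∃ k : ℕ, k ≤ γmax ∧ F.LagAdj X k Y

theorem adj_of_lagAdj {X Y : V} {k : ℕ} (h : F.LagAdj X k Y) (t : ℤ) :
    F.Adj (X, t - k) (Y, t) := by
  have := (F.shift X Y _ _ t).1 h
  simpa [sub_eq_neg_add] using this

/-- From any starting time on, edges can only be followed backwards finitely often. -/
theorem wellFounded_from [Finite V] (s : ℤ) :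
    WellFounded (fun u w : V × ℤ => F.Adj u w ∧ s ≤ u.2) := by
  let r : V → V → Prop := Relation.TransGen (fun a b => F.Adj (a, 0) (b, 0))
  have hirr : Std.Irrefl r := ⟨fun a h => F.acyclic (a, 0)
    (Relation.TransGen.lift (p := F.Adj) (fun v : V => ((v, 0) : V × ℤ)) (fun _ _ h => h) _ _
      h)⟩
  have htr : IsTrans V r := ⟨fun _ _ _ => Relation.TransGen.trans⟩
  have hr : WellFounded r := Finite.wellFounded_of_trans_of_irrefl r
  have hlex : WellFounded (Prod.Lex (fun a b : ℕ => a < b) r) :=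
    WellFounded.prod_lex Nat.lt_wfRel.wf hr
  refine Subrelation.wf ?_ (InvImage.wf (fun u : V × ℤ => ((u.2 - s).toNat, u.1)) hlex)
  rintro ⟨X, a⟩ ⟨Y, b⟩ ⟨hadj, hs⟩
  have hle : a ≤ b := F.le_of_adj hadj
  have hs' : s ≤ a := hs
  rcases hle.lt_or_eq with hlt | rfl
  · exact Prod.Lex.left _ _ (by omega)
  · refine Prod.Lex.right _ (Relation.TransGen.single ?_)
    have := (F.shift X Y a a (-a)).1 hadj
    simpa using this

end FTCG

/-- An extended summary causal graph or a summary causal graph over the series `V`. -/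
inductive CausalAbstraction (V : Type*) where
  | escg (G : Digraph (ESCGVertex V))
  | scg (G : Digraph V)

namespace CausalAbstraction

variable {V : Type*}

/-- The candidate full-time causal graphs of `G`: those from which `G` is derived. -/
def candidates (γmax : ℕ) : CausalAbstraction V → Set (FTCG V γmax)
  | .escg G => {F | F.escg = G}
  | .scg G => {F | F.scg = G}

/-- The backdoor criterion over all candidate full-time causal graphs, relative to `(x, y)`. -/
def SatisfiesBackdoor (γmax : ℕ) (G : CausalAbstraction V) (x y : V × ℤ) (Z : Set (V × ℤ)) :
    Prop :=
  ∀ F ∈ G.candidates γmax,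
    (∀ π, F.IsBackdoorPath π x y → F.Blocks Z π x y) ∧ ∀ z ∈ Z, ¬ F.IsDescendant x z

end CausalAbstraction

/-! ### Dynamic structural causal models -/

/-- The trajectories of time series in which the series `X` has the state space `S X`. -/
abbrev Trajectory {V : Type*} (S : V → Type*) : Type _ := ∀ u : V × ℤ, S u.1

/-- A dynamic structural causal model with full-time causal graph `F` and state spaces `S`.
The structural function of a series reads its parents and its own noise and does not depend on
time (consistency throughout time). The noises are jointly independent, and every variable is
determined by the noises of its ancestors, so that no two observed variables have a hidden common
cause (causal sufficiency), not even one in the infinitely remote past. -/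
structure DSCM {V : Type*} {γmax : ℕ} (S : V → Type*) [∀ X, MeasurableSpace (S X)]
    (F : FTCG V γmax) where
  /-- The probability space that carries the noises. -/
  Ω : Type w
  [measurableSpaceΩ : MeasurableSpace Ω]
  /-- The probability measure on it. -/
  μ : Measure Ω
  [isProbabilityMeasure : IsProbabilityMeasure μ]
  /-- The space of values of the noise of each series. -/
  Noise : V → Type w
  [measurableSpaceNoise : ∀ X, MeasurableSpace (Noise X)]
  /-- The noises. -/
  noise : ∀ u : V × ℤ, Ω → Noise u.1
  /-- The structural functions. -/
  f : ∀ X : V, (∀ p : F.Pa X, S p.1.1) → Noise X → S X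
  /-- The observed variables. -/
  val : ∀ u : V × ℤ, Ω → S u.1
  measurable_noise : ∀ u, Measurable (noise u)
  indep_noise : iIndepFun noise μ
  measurable_f : ∀ X, Measurable (fun a : (∀ p : F.Pa X, S p.1.1) × Noise X => f X a.1 a.2)
  measurable_val : ∀ u, Measurable[⨆ a ∈ {a | F.IsDescendant a u},
    MeasurableSpace.comap (noise a) (measurableSpaceNoise a.1)] (val u)
  structural_eq : ∀ (X : V) (t : ℤ) (ω : Ω),
    val (X, t) ω = f X (fun p => val (p.1.1, t - p.1.2) ω) (noise (X, t) ω)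

attribute [instance] DSCM.measurableSpaceΩ DSCM.isProbabilityMeasure DSCM.measurableSpaceNoise

namespace DSCM

variable {V : Type*} {γmax : ℕ} {S : V → Type*} [∀ X, MeasurableSpace (S X)] {F : FTCG V γmax}
  (M : DSCM S F)

/-- The joint distribution `P` of the observed variables. -/
noncomputable def law : Measure (Trajectory S) := M.μ.map (fun ω u => M.val u ω)

open Classical in
/-- The variables under the intervention `do(x₀ = a)`: the structural equation of the variable
`x₀` is replaced by the constant `a`, all other structural equations are kept. What happens before
the intervention is unchanged; from then on the values are computed recursively. -/
noncomputable def doVal [Finite V] (x₀ : V × ℤ) (a : S x₀.1) (ω : M.Ω) : ∀ u : V × ℤ, S u.1 :=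
  (F.wellFounded_from x₀.2).fix fun u rec =>
    if h : u = x₀ then h ▸ a
    else if u.2 < x₀.2 then M.val u ω
    else M.f u.1
      (fun p => if hp : x₀.2 ≤ u.2 - p.1.2 then
          rec (p.1.1, u.2 - p.1.2) ⟨F.adj_of_lagAdj p.2 u.2, hp⟩
        else M.val (p.1.1, u.2 - p.1.2) ω)
      (M.noise u ω)

theorem doVal_self [Finite V] (x₀ : V × ℤ) (a : S x₀.1) (ω : M.Ω) :
    M.doVal x₀ a ω x₀ = a := by
  rw [doVal, WellFounded.fix_eq]
  simp

theorem doVal_of_lt [Finite V] (x₀ : V × ℤ) (a : S x₀.1) (ω : M.Ω) {u : V × ℤ}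
    (hu : u.2 < x₀.2) : M.doVal x₀ a ω u = M.val u ω := by
  have hne : u ≠ x₀ := by rintro rfl; exact lt_irrefl _ hu
  rw [doVal, WellFounded.fix_eq]
  simp [hne, hu]

theorem doVal_structural_eq [Finite V] (x₀ : V × ℤ) (a : S x₀.1) (ω : M.Ω) (X : V) (t : ℤ)
    (hne : (X, t) ≠ x₀) :
    M.doVal x₀ a ω (X, t) =
      M.f X (fun p => M.doVal x₀ a ω (p.1.1, t - p.1.2)) (M.noise (X, t) ω) := by
  by_cases ht : t < x₀.2
  · rw [M.doVal_of_lt x₀ a ω (u := (X, t)) ht, M.structural_eq]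
    congr 1
    funext p
    rw [M.doVal_of_lt]
    show t - (p.1.2 : ℤ) < x₀.2
    omega
  · conv_lhs => rw [doVal, WellFounded.fix_eq]
    rw [dif_neg hne, if_neg ht]
    congr 1
    funext p
    by_cases hp : x₀.2 ≤ t - p.1.2
    · simp only [dif_pos hp]
      rfl
    · rw [dif_neg hp, M.doVal_of_lt]
      exact not_le.1 hp

/-- The total effect `P(y₀ = b | do(x₀ = a))`. -/
noncomputable def totalEffect [Finite V] (x₀ y₀ : V × ℤ) (a : S x₀.1) (b : S y₀.1) : ENNReal :=
  M.μ {ω | M.doVal x₀ a ω y₀ = b}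

end DSCM

section Identification

variable {V : Type*} {S : V → Type*} [∀ X, MeasurableSpace (S X)]

/-- Positivity of a joint distribution of discrete variables: finitely many variables take any
prescribed values with positive probability. -/
def IsPositiveLaw (P : Measure (Trajectory S)) : Prop :=
  ∀ (A : Finset (V × ℤ)) (h₀ : Trajectory S), 0 < P {h | ∀ u ∈ A, h u = h₀ u}

/-- The adjustment formula `∑_z P(y₀ = b | x₀ = a, Z = z) P(Z = z)`. -/
noncomputable def adjustment (P : Measure (Trajectory S)) (x₀ y₀ : V × ℤ) (Z : Finset (V × ℤ))
    (a : S x₀.1) (b : S y₀.1) : ENNReal :=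
  ∑' z : (∀ u : Z, S u.1.1),
    P[{h | h y₀ = b} | {h | h x₀ = a ∧ ∀ u : Z, h u.1 = z u}] * P {h | ∀ u : Z, h u.1 = z u}

/-- Identifiability of the total effect of `x₀` on `y₀` in an abstraction `G`: some do-free
formula, i.e. some function of the joint distribution of the observed variables alone, gives the
total effect in every model with positive distribution whose graph is any candidate of `G`. -/
def Identifiable [Finite V] (γmax : ℕ) (S : V → Type*) [∀ X, MeasurableSpace (S X)]
    (G : CausalAbstraction V) (x₀ y₀ : V × ℤ) : Prop :=
  ∃ Φ : Measure (Trajectory S) → S x₀.1 → S y₀.1 → ENNReal,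
    ∀ F ∈ G.candidates γmax, ∀ M : DSCM.{w} S F, IsPositiveLaw M.law →
      ∀ a b, M.totalEffect x₀ y₀ a b = Φ M.law a b

end Identification

/-!
In the graph without the edges out of `x₀` and `Z`, a path between `x₀` and `y₀` that is open at
its colliders would be an active backdoor path of the original graph. When `Z` blocks all of these,
the relevant vertices therefore split into two disjoint parts, each closed under taking parents in
the pruned graph, one containing `x₀` and the other `y₀` (unless `y₀ ∈ Z`), with `Z` distributed
over both.

Solve the structural equations with `x₀` and `Z` held fixed at prescribed values. A variable of one
part is then a function of the noises of that part alone, so the two parts are independent. The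
event that `Z` is observed at its prescribed values coincides with the event that the structural
equations of `Z` reproduce these values when `x₀` and `Z` are held fixed, hence is an intersection
of one event from each part. Observing `x₀` only adds to the event from its own part, whereas the
outcome `y₀` under `do(x₀)` belongs to the other one. Given `Z`, the outcome under `do(x₀)` is thus
independent of the observed `x₀`, and averaging over the values of `Z` gives the adjustment formula.
-/

/-! ### Separation in directed graphs -/

section Separation

variable {α : Type*} {G : Digraph α} {I Z : Set α} {x y : α}

/-- The vertices with a descendant in `W`; as every vertex is its own descendant, they include
`W`. -/
def ancestors (G : Digraph α) (W : Set α) : Set α := {u | ∃ w ∈ W, G.IsDescendant u w}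

/-- A set of vertices that contains all parents of its elements. -/
def ParentClosed (G : Digraph α) (B : Set α) : Prop := ∀ ⦃p u⦄, G.Adj p u → u ∈ B → p ∈ B

/-- The graph `G` without the edges out of the vertices in `I`. Conditioning on a variable, or
intervening on it, makes its children insensitive to its other causes and so acts like this. -/
def removeOutgoing (G : Digraph α) (I : Set α) : Digraph α where
  Adj u v := G.Adj u v ∧ u ∉ I

/-- A path from `v` to `x` on which every collider has a descendant in `Z`. Non-colliders are
unrestricted: the graphs of interest have no edges out of `Z`. -/
def IsOpenPath (G : Digraph α) (Z : Set α) (π : List α) (v x : α) : Prop :=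
  G.IsPathBetween π v x ∧ ∀ b, G.IsColliderOn π b → b ∈ ancestors G Z

/-- The vertices joined to `x` by an open path. -/
def openReach (G : Digraph α) (Z : Set α) (x : α) : Set α := {v | ∃ π, IsOpenPath G Z π v x}

theorem subset_ancestors (W : Set α) : W ⊆ ancestors G W := fun u hu => ⟨u, hu, .refl⟩

theorem mem_ancestors_of_adj {W : Set α} {p u : α} (hpu : G.Adj p u) (hu : u ∈ ancestors G W) :
    p ∈ ancestors G W :=
  let ⟨w, hw, huw⟩ := hu
  ⟨w, hw, .head hpu huw⟩

theorem ancestors_removeOutgoing_subset (W : Set α) :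
    ancestors (removeOutgoing G I) W ⊆ ancestors G W := fun _ ⟨w, hw, huw⟩ =>
  ⟨w, hw, Relation.ReflTransGen.mono (r := (removeOutgoing G I).Adj) (fun _ _ h => h.1) _ _ huw⟩

instance [Std.Asymm G.Adj] : Std.Asymm (removeOutgoing G I).Adj :=
  ⟨fun _ _ h h' => Std.Asymm.asymm _ _ h.1 h'.1⟩

theorem exists_nodup_isChain_of_reflTransGen {r : α → α → Prop} {u v : α}
    (h : Relation.ReflTransGen r u v) :
    ∃ l, (u :: l).Nodup ∧ (u :: l).IsChain r ∧ (u :: l).getLast? = some v := by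
  induction h using Relation.ReflTransGen.head_induction_on with
  | refl => exact ⟨[], by simp⟩
  | @head u w huw _ ih =>
    obtain ⟨l, hnodup, hchain, hlast⟩ := ih
    by_cases hu : u ∈ w :: l
    · obtain ⟨s, t, hst⟩ := List.append_of_mem hu
      rw [hst] at hnodup hchain hlast
      exact ⟨t, hnodup.of_append_right, hchain.right_of_append,
        by rwa [List.getLast?_append_of_ne_nil _ (List.cons_ne_nil u t)] at hlast⟩
    · exact ⟨w :: l, List.nodup_cons.2 ⟨hu, hnodup⟩, hchain.cons_cons huw,
        by rwa [List.getLast?_cons_cons]⟩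

theorem mem_openReach_self : x ∈ openReach G Z x := by
  refine ⟨[x], ⟨by simp, by simp, by simp, by simp⟩, ?_⟩
  rintro b ⟨a, c, habc, -⟩
  simpa using habc.length_le

theorem mem_openReach_of_isDescendant [Std.Asymm G.Adj] {v : α} (h : G.IsDescendant v x) :
    v ∈ openReach G Z x := by
  obtain ⟨l, hnodup, hchain, hlast⟩ := exists_nodup_isChain_of_reflTransGen h
  refine ⟨v :: l, ⟨hnodup, by simp, hlast, hchain.imp fun _ _ => Or.inl⟩, ?_⟩
  rintro b ⟨a, c, habc, -, hcb⟩
  have hbc : G.Adj b c := by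
    have := hchain.infix habc
    simp only [List.isChain_cons_cons] at this
    exact this.2.1
  exact absurd hcb (Std.Asymm.asymm _ _ hbc)

theorem IsOpenPath.suffix {π π' : List α} {v v' : α} (h : IsOpenPath G Z π v x) (hs : π' <:+ π)
    (hhead : π'.head? = some v') : IsOpenPath G Z π' v' x := by
  obtain ⟨⟨hnodup, -, hlast, hchain⟩, hcol⟩ := h
  have hne : π' ≠ [] := by rintro rfl; simp at hhead
  refine ⟨⟨hnodup.sublist hs.sublist, hhead, ?_, hchain.suffix hs⟩, ?_⟩
  · obtain ⟨s, rfl⟩ := hs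
    rwa [List.getLast?_append_of_ne_nil _ hne] at hlast
  · rintro b ⟨a, c, habc, hb⟩
    exact hcol b ⟨a, c, habc.trans hs.isInfix, hb⟩

theorem IsOpenPath.cons [Std.Asymm G.Adj] {π : List α} {u v : α} (h : IsOpenPath G Z π u x)
    (hv : v ∉ π) (huv : G.Adj u v ∨ G.Adj v u ∧ u ∈ ancestors G Z) :
    IsOpenPath G Z (v :: π) v x := by
  obtain ⟨⟨hnodup, hhead, hlast, hchain⟩, hcol⟩ := h
  obtain ⟨l, rfl⟩ := List.head?_eq_some_iff.1 hhead
  refine ⟨⟨List.nodup_cons.2 ⟨hv, hnodup⟩, rfl, by rwa [List.getLast?_cons_cons],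
    hchain.cons_cons (huv.symm.imp_left And.left)⟩, ?_⟩
  rintro b ⟨a, c, habc, hab, hcb⟩
  rcases List.infix_cons_iff.1 habc with hpre | hinf
  · obtain ⟨rfl, rfl, -⟩ : a = v ∧ b = u ∧ [c] <+: l := by
      simpa only [List.cons_prefix_cons] using hpre
    exact huv.elim (fun hba => absurd hab (Std.Asymm.asymm _ _ hba)) And.right
  · exact hcol b ⟨a, c, hinf, hab, hcb⟩

theorem mem_openReach_of_adj [Std.Asymm G.Adj] {u v : α} (hu : u ∈ openReach G Z x)
    (huv : G.Adj u v ∨ G.Adj v u ∧ u ∈ ancestors G Z) : v ∈ openReach G Z x := by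
  obtain ⟨π, hπ⟩ := hu
  by_cases hv : v ∈ π
  · obtain ⟨s, t, rfl⟩ := List.append_of_mem hv
    exact ⟨v :: t, hπ.suffix (List.suffix_append s _) rfl⟩
  · exact ⟨v :: π, hπ.cons hv huv⟩

theorem mem_openReach_of_isDescendant_of_mem [Std.Asymm G.Adj] {u v : α}
    (hu : u ∈ openReach G Z x) (huv : G.IsDescendant u v) : v ∈ openReach G Z x := by
  induction huv with
  | refl => exact hu
  | tail _ hadj ih => exact mem_openReach_of_adj ih (Or.inl hadj)

theorem mem_openReach_iff_of_adj [Std.Asymm G.Adj] (hy : y ∉ openReach G Z x) {p u : α}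
    (hpu : G.Adj p u) (hu : u ∈ ancestors G (insert x (insert y Z))) :
    p ∈ openReach G Z x ↔ u ∈ openReach G Z x := by
  refine ⟨fun hp => mem_openReach_of_adj hp (Or.inl hpu), fun hreach => ?_⟩
  obtain ⟨w, rfl | rfl | hw, huw⟩ := hu
  · exact mem_openReach_of_isDescendant (.head hpu huw)
  · exact absurd (mem_openReach_of_isDescendant_of_mem hreach huw) hy
  · exact mem_openReach_of_adj hreach (Or.inr ⟨hpu, w, hw, huw⟩)

theorem IsOpenPath.reverse {π : List α} {u v : α} (h : IsOpenPath G Z π u v) :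
    IsOpenPath G Z π.reverse v u := by
  obtain ⟨⟨hnodup, hhead, hlast, hchain⟩, hcol⟩ := h
  refine ⟨⟨List.nodup_reverse.2 hnodup, by rwa [List.head?_reverse], by rwa [List.getLast?_reverse],
    List.isChain_reverse.2 (hchain.imp fun _ _ => Or.symm)⟩, ?_⟩
  rintro b ⟨a, c, habc, hab, hcb⟩
  exact hcol b ⟨c, a, by simpa using List.reverse_infix.2 habc, hcb, hab⟩

theorem adj_removeOutgoing_of_isChain [Std.Asymm G.Adj] {π : List α} {a b : α}
    (hchain : π.IsChain fun u v => (removeOutgoing G I).Adj u v ∨ (removeOutgoing G I).Adj v u)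
    (hπ : [a, b] <:+: π ∨ [b, a] <:+: π) (hab : G.Adj a b) : (removeOutgoing G I).Adj a b := by
  have hadj : (removeOutgoing G I).Adj a b ∨ (removeOutgoing G I).Adj b a := by
    rcases hπ with h | h
    · simpa using hchain.infix h
    · simpa [or_comm] using hchain.infix h
  exact hadj.resolve_right fun hba => Std.Asymm.asymm _ _ hab hba.1

theorem isBackdoorPath_of_isPathBetween_removeOutgoing {π : List α} (hxy : x ≠ y) (hx : x ∈ I)
    (hπ : (removeOutgoing G I).IsPathBetween π x y) : G.IsBackdoorPath π x y := by
  obtain ⟨hnodup, hhead, hlast, hchain⟩ := hπ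
  refine ⟨⟨hnodup, hhead, hlast, hchain.imp fun _ _ h => h.imp And.left And.left⟩, ?_⟩
  obtain ⟨l, rfl⟩ := List.head?_eq_some_iff.1 hhead
  cases l with
  | nil => exact absurd (by simpa using hlast) hxy
  | cons w l =>
    exact ⟨w, ⟨l, rfl⟩, (hchain.rel.resolve_left fun hxw => hxw.2 hx).1⟩

theorem IsOpenPath.isActive_of_removeOutgoing [Std.Asymm G.Adj] {π : List α} (hZ : Z ⊆ I)
    (hxZ : x ∉ Z) (hyZ : y ∉ Z) (hπ : IsOpenPath (removeOutgoing G I) Z π x y) :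
    G.IsActive Z π x y := by
  obtain ⟨⟨-, -, -, hchain⟩, hcol⟩ := hπ
  have hleft {a b c : α} (h : [a, b, c] <:+: π) : [a, b] <:+: π :=
    (List.prefix_append [a, b] [c]).isInfix.trans h
  have hright {a b c : α} (h : [a, b, c] <:+: π) : [b, c] <:+: π :=
    (List.suffix_cons a [b, c]).isInfix.trans h
  refine ⟨hxZ, hyZ, ?_, ?_⟩
  · rintro b ⟨a, c, habc, hba | hbc⟩ hb
    · exact (adj_removeOutgoing_of_isChain hchain (.inr (hleft habc)) hba).2 (hZ hb)
    · exact (adj_removeOutgoing_of_isChain hchain (.inl (hright habc)) hbc).2 (hZ hb)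
  · rintro b ⟨a, c, habc, hab, hcb⟩
    exact ancestors_removeOutgoing_subset Z (hcol b ⟨a, c, habc,
      adj_removeOutgoing_of_isChain hchain (.inl (hleft habc)) hab,
      adj_removeOutgoing_of_isChain hchain (.inr (hright habc)) hcb⟩)

theorem notMem_openReach_of_blocks_backdoor [Std.Asymm G.Adj] (hxy : x ≠ y) (hxZ : x ∉ Z)
    (hyZ : y ∉ Z) (hblock : ∀ π, G.IsBackdoorPath π x y → G.Blocks Z π x y) :
    y ∉ openReach (removeOutgoing G (insert x Z)) Z x := by
  rintro ⟨π, hπ⟩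
  exact hblock π.reverse
    (isBackdoorPath_of_isPathBetween_removeOutgoing hxy (Set.mem_insert x Z) hπ.reverse.1)
    (hπ.reverse.isActive_of_removeOutgoing (Set.subset_insert x Z) hxZ hyZ)

theorem exists_parentClosed_separation [Std.Asymm G.Adj] (hxy : x ≠ y) (hxZ : x ∉ Z)
    (hblock : ∀ π, G.IsBackdoorPath π x y → G.Blocks Z π x y) :
    ∃ B₁ B₂ : Set α, Disjoint B₁ B₂ ∧ ParentClosed (removeOutgoing G (insert x Z)) B₁ ∧
      ParentClosed (removeOutgoing G (insert x Z)) B₂ ∧ x ∈ B₁ ∧ y ∈ Z ∪ B₂ ∧ Z ⊆ B₁ ∪ B₂ := by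
  by_cases hyZ : y ∈ Z
  · exact ⟨Set.univ, ∅, by simp, fun _ _ _ _ => trivial, fun _ _ _ => id, trivial, .inl hyZ,
      by simp⟩
  set H := removeOutgoing G (insert x Z)
  set A := ancestors H (insert x (insert y Z))
  have hy : y ∉ openReach H Z x := notMem_openReach_of_blocks_backdoor hxy hxZ hyZ hblock
  have hA : insert x (insert y Z) ⊆ A := subset_ancestors _
  refine ⟨A ∩ openReach H Z x, A \ openReach H Z x,
    Set.disjoint_sdiff_right.mono_left Set.inter_subset_right,
    fun p u hpu hu => ⟨mem_ancestors_of_adj hpu hu.1,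
      (mem_openReach_iff_of_adj hy hpu hu.1).2 hu.2⟩,
    fun p u hpu hu => ⟨mem_ancestors_of_adj hpu hu.1,
      fun hp => hu.2 ((mem_openReach_iff_of_adj hy hpu hu.1).1 hp)⟩,
    ⟨hA (by simp), mem_openReach_self⟩, .inr ⟨hA (by simp), hy⟩, ?_⟩
  rw [Set.inter_union_sdiff]
  exact fun z hz => hA (by simp [hz])

end Separation

/-! ### Structural equations with several variables held fixed -/

namespace FTCG

variable {V : Type*} {γmax : ℕ} (F : FTCG V γmax)

instance : Std.Asymm F.Adj := ⟨fun u _ huv hvu => F.acyclic u (.tail (.single huv) hvu)⟩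

theorem induction_from [Finite V] (s : ℤ) {P : V × ℤ → Prop} (base : ∀ u, u.2 < s → P u)
    (step : ∀ u, s ≤ u.2 → (∀ p, F.Adj p u → P p) → P u) (u : V × ℤ) : P u := by
  induction u using (F.wellFounded_from s).induction with
  | _ u ih =>
    rcases lt_or_ge u.2 s with hu | hu
    · exact base u hu
    · exact step u hu fun p hp => (lt_or_ge p.2 s).elim (base p) fun hps => ih p ⟨hp, hps⟩

theorem mem_of_isDescendant_of_lt {I B : Set (V × ℤ)} {s : ℤ} (hs : ∀ v ∈ I, s ≤ v.2)
    (hB : ParentClosed (removeOutgoing F.toDigraph I) B) {u a : V × ℤ} (hu : u ∈ B)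
    (hus : u.2 < s) (hau : F.IsDescendant a u) : a ∈ B := by
  suffices a ∈ B ∧ a.2 < s from this.1
  induction hau using Relation.ReflTransGen.head_induction_on with
  | refl => exact ⟨hu, hus⟩
  | @head a c hac _ ih =>
    have has : a.2 < s := (F.le_of_adj hac).trans_lt ih.2
    exact ⟨hB ⟨hac, fun haI => (hs a haI).not_gt has⟩ ih.1, has⟩

end FTCG

namespace DSCM

variable {V : Type*} {γmax : ℕ} {S : V → Type*} [∀ X, MeasurableSpace (S X)] {F : FTCG V γmax}
  (M : DSCM S F)

/-- The value that the structural equation of `u` gives when the parents of `u` have their values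
in `g`. -/
def mechanism (g : Trajectory S) (ω : M.Ω) (u : V × ℤ) : S u.1 :=
  M.f u.1 (fun p => g (p.1.1, u.2 - p.1.2)) (M.noise u ω)

/-- The trajectory `g` satisfies the structural equations of all variables outside `I`. -/
def SolvesOff (ω : M.Ω) (I : Set (V × ℤ)) (g : Trajectory S) : Prop :=
  ∀ u ∉ I, g u = M.mechanism g ω u

open Classical in
/-- The variables when those in `I` are held fixed at their values in `h`. Nothing else is changed
before the time `s`, which is meant to precede `I`; from then on the values are computed
recursively. -/
noncomputable def fixedVal [Finite V] (I : Set (V × ℤ)) (h : Trajectory S) (s : ℤ) (ω : M.Ω) :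
    Trajectory S :=
  (F.wellFounded_from s).fix fun u rec =>
    if u ∈ I then h u
    else if u.2 < s then M.val u ω
    else M.f u.1
      (fun p => if hp : s ≤ u.2 - p.1.2 then
          rec (p.1.1, u.2 - p.1.2) ⟨F.adj_of_lagAdj p.2 u.2, hp⟩
        else M.val (p.1.1, u.2 - p.1.2) ω)
      (M.noise u ω)

variable {M} in
theorem mechanism_congr {g g' : Trajectory S} {ω : M.Ω} {u : V × ℤ}
    (h : ∀ p, F.Adj p u → g p = g' p) : M.mechanism g ω u = M.mechanism g' ω u :=
  congrArg (M.f u.1 · (M.noise u ω)) (funext fun p => h _ (F.adj_of_lagAdj p.2 u.2))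

theorem val_eq_mechanism (ω : M.Ω) (u : V × ℤ) :
    M.val u ω = M.mechanism (fun v => M.val v ω) ω u :=
  M.structural_eq u.1 u.2 ω

theorem solvesOff_val (ω : M.Ω) (I : Set (V × ℤ)) : M.SolvesOff ω I fun u => M.val u ω :=
  fun u _ => M.val_eq_mechanism ω u

variable {M} in
theorem SolvesOff.mono {ω : M.Ω} {I J : Set (V × ℤ)} {g : Trajectory S} (hg : M.SolvesOff ω J g)
    (hJI : J ⊆ I) : M.SolvesOff ω I g :=
  fun u hu => hg u fun huJ => hu (hJI huJ)

variable [Finite V] {I : Set (V × ℤ)} {s : ℤ} {ω : M.Ω}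

theorem solvesOff_doVal (x₀ : V × ℤ) (a : S x₀.1) (ω : M.Ω) :
    M.SolvesOff ω {x₀} (M.doVal x₀ a ω) :=
  fun u hu => M.doVal_structural_eq x₀ a ω u.1 u.2 hu

variable {M} in
theorem SolvesOff.eq {g g' : Trajectory S} (hg : M.SolvesOff ω I g) (hg' : M.SolvesOff ω I g')
    (hI : ∀ u ∈ I, g u = g' u) (hs : ∀ u, u.2 < s → g u = g' u) : g = g' := by
  funext u
  induction u using F.induction_from s with
  | base u hu => exact hs u hu
  | step u _ ih =>
    by_cases hu : u ∈ I
    · exact hI u hu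
    · rw [hg u hu, hg' u hu, mechanism_congr ih]

theorem doVal_of_val_eq {x₀ : V × ℤ} {a : S x₀.1} (ha : M.val x₀ ω = a) :
    M.doVal x₀ a ω = fun u => M.val u ω := by
  refine (M.solvesOff_doVal x₀ a ω).eq (M.solvesOff_val ω _) ?_ fun u => M.doVal_of_lt x₀ a ω
  rintro _ rfl
  rw [M.doVal_self, ha]

theorem doVal_of_not_isDescendant (x₀ : V × ℤ) (a : S x₀.1) (ω : M.Ω) {u : V × ℤ}
    (hu : ¬ F.IsDescendant x₀ u) : M.doVal x₀ a ω u = M.val u ω := by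
  induction u using F.induction_from x₀.2 with
  | base u h => exact M.doVal_of_lt x₀ a ω h
  | step u _ ih =>
    have hne : u ≠ x₀ := by rintro rfl; exact hu .refl
    rw [M.solvesOff_doVal x₀ a ω u hne, M.val_eq_mechanism]
    exact mechanism_congr fun p hp => ih p hp fun h => hu (h.tail hp)

section FixedVal

variable (h : Trajectory S)

theorem fixedVal_of_mem {u : V × ℤ} (hu : u ∈ I) : M.fixedVal I h s ω u = h u := by
  rw [fixedVal, WellFounded.fix_eq, if_pos hu]

theorem fixedVal_of_lt (hI : ∀ v ∈ I, s ≤ v.2) {u : V × ℤ} (hu : u.2 < s) :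
    M.fixedVal I h s ω u = M.val u ω := by
  rw [fixedVal, WellFounded.fix_eq, if_neg fun huI => (hI u huI).not_gt hu, if_pos hu]

theorem solvesOff_fixedVal (hI : ∀ v ∈ I, s ≤ v.2) : M.SolvesOff ω I (M.fixedVal I h s ω) := by
  intro u hu
  rcases lt_or_ge u.2 s with hus | hus
  · rw [M.fixedVal_of_lt h hI hus, M.val_eq_mechanism]
    exact mechanism_congr fun p hp =>
      (M.fixedVal_of_lt h hI ((F.le_of_adj hp).trans_lt hus)).symm
  · conv_lhs => rw [fixedVal, WellFounded.fix_eq, if_neg hu, if_neg hus.not_gt]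
    refine congrArg (M.f u.1 · (M.noise u ω)) (funext fun p => ?_)
    split_ifs with hp
    · rfl
    · exact (M.fixedVal_of_lt h hI (u := (p.1.1, u.2 - p.1.2)) (not_le.1 hp)).symm

variable {M h}

theorem SolvesOff.eq_fixedVal {g : Trajectory S} (hg : M.SolvesOff ω I g)
    (hgI : ∀ v ∈ I, g v = h v) (hpast : ∀ u, u.2 < s → g u = M.val u ω)
    (hI : ∀ v ∈ I, s ≤ v.2) : g = M.fixedVal I h s ω :=
  hg.eq (M.solvesOff_fixedVal h hI) (fun u hu => by rw [hgI u hu, M.fixedVal_of_mem h hu])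
    fun u hu => by rw [hpast u hu, M.fixedVal_of_lt h hI hu]

theorem SolvesOff.forall_eq_iff {J : Set (V × ℤ)} {g : Trajectory S} (hg : M.SolvesOff ω J g)
    (hJI : J ⊆ I) (hgJ : ∀ v ∈ J, g v = h v) (hpast : ∀ u, u.2 < s → g u = M.val u ω)
    (hI : ∀ v ∈ I, s ≤ v.2) :
    (∀ v ∈ I, g v = h v) ↔ ∀ v ∈ I \ J, M.mechanism (M.fixedVal I h s ω) ω v = h v := by
  constructor
  · intro hgI v hv
    rw [← (hg.mono hJI).eq_fixedVal hgI hpast hI, ← hg v hv.2, hgI v hv.1]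
  · intro hmech
    have hsolves : M.SolvesOff ω J (M.fixedVal I h s ω) := fun u huJ => by
      by_cases hu : u ∈ I
      · rw [hmech u ⟨hu, huJ⟩, M.fixedVal_of_mem h hu]
      · exact M.solvesOff_fixedVal h hI u hu
    have heq : g = M.fixedVal I h s ω :=
      hg.eq hsolves (fun u hu => by rw [hgJ u hu, M.fixedVal_of_mem h (hJI hu)])
        fun u hu => by rw [hpast u hu, M.fixedVal_of_lt h hI hu]
    exact fun v hv => heq ▸ M.fixedVal_of_mem h hv

end FixedVal

end DSCM

/-! ### Conditional exchangeability -/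

theorem cond_congr_of_forall_mem {Ω : Type*} {mΩ : MeasurableSpace Ω} {μ : Measure Ω}
    {C D D' : Set Ω} (hC : MeasurableSet C) (h : ∀ ω ∈ C, ω ∈ D ↔ ω ∈ D') :
    μ[D | C] = μ[D' | C] := by
  have hinter : C ∩ D = C ∩ D' := Set.ext fun ω => and_congr_right (h ω)
  rw [cond_apply hC, cond_apply hC, hinter]

theorem cond_inter_eq_cond_of_indep {Ω : Type*} {m₁ m₂ mΩ : MeasurableSpace Ω} {μ : Measure Ω}
    [IsFiniteMeasure μ] (hm₁ : m₁ ≤ mΩ) (hm₂ : m₂ ≤ mΩ) (hindep : Indep m₁ m₂ μ)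
    {E₁ E₂ D : Set Ω} (hE₁ : MeasurableSet[m₁] E₁) (hE₂ : MeasurableSet[m₂] E₂)
    (hD : MeasurableSet[m₂] D) (hE₁0 : μ E₁ ≠ 0) : μ[D | E₁ ∩ E₂] = μ[D | E₂] := by
  have hfactor := (Indep_iff m₁ m₂ μ).1 hindep E₁
  rw [cond_apply ((hm₁ _ hE₁).inter (hm₂ _ hE₂)), cond_apply (hm₂ _ hE₂), Set.inter_assoc,
    hfactor _ hE₁ hE₂, hfactor _ hE₁ (hE₂.inter hD),
    ENNReal.mul_inv (.inl hE₁0) (.inl (measure_ne_top μ E₁)), mul_mul_mul_comm,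
    ENNReal.inv_mul_cancel hE₁0 (measure_ne_top μ E₁), one_mul]

theorem tsum_measure_preimage_singleton_inter {Ω β : Type*} [MeasurableSpace Ω]
    [MeasurableSpace β] [Countable β] [MeasurableSingletonClass β] (μ : Measure Ω) {f : Ω → β}
    (hf : Measurable f) (E : Set Ω) : ∑' z, μ (f ⁻¹' {z} ∩ E) = μ E := by
  have hmeas (z : β) : MeasurableSet (f ⁻¹' {z}) := hf (measurableSet_singleton z)
  have htsum := (tsum_univ fun z => μ.restrict E (f ⁻¹' {z})).symm.trans
    (tsum_measure_preimage_singleton (μ := μ.restrict E) Set.countable_univ fun z _ => hmeas z)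
  rw [Set.preimage_univ, Measure.restrict_apply_univ] at htsum
  simpa only [Measure.restrict_apply (hmeas _)] using htsum

theorem cond_map_apply {Ω β : Type*} [MeasurableSpace Ω] [MeasurableSpace β] {μ : Measure Ω}
    {f : Ω → β} (hf : Measurable f) {C D : Set β} (hC : MeasurableSet C) (hD : MeasurableSet D) :
    (μ.map f)[D | C] = μ[f ⁻¹' D | f ⁻¹' C] := by
  rw [cond_apply hC, cond_apply (hf hC), Measure.map_apply hf hC,
    Measure.map_apply hf (hC.inter hD), Set.preimage_inter]

theorem measurableSet_forall_eq {V : Type*} {S : V → Type*} [∀ X, MeasurableSpace (S X)]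
    [∀ X, MeasurableSingletonClass (S X)] {I : Set (V × ℤ)} (hI : I.Finite) (h : Trajectory S) :
    MeasurableSet {g : Trajectory S | ∀ u ∈ I, g u = h u} := by
  simp only [Set.ofPred_forall]
  exact hI.measurableSet_biInter fun u _ =>
    (measurable_pi_apply u : Measurable fun g : Trajectory S => g u) (measurableSet_singleton (h u))

namespace DSCM

variable {V : Type*} {γmax : ℕ} {S : V → Type*} [∀ X, MeasurableSpace (S X)] {F : FTCG V γmax}
  (M : DSCM S F)

/-- The σ-algebra generated by the noises of the variables in `B`. -/
abbrev noiseSigma (B : Set (V × ℤ)) : MeasurableSpace M.Ω :=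
  ⨆ b ∈ B, MeasurableSpace.comap (M.noise b) (M.measurableSpaceNoise b.1)

theorem comap_noise_le (b : V × ℤ) :
    MeasurableSpace.comap (M.noise b) (M.measurableSpaceNoise b.1) ≤ M.measurableSpaceΩ :=
  (M.measurable_noise b).comap_le

theorem noiseSigma_le (B : Set (V × ℤ)) : M.noiseSigma B ≤ M.measurableSpaceΩ :=
  iSup₂_le fun b _ => M.comap_noise_le b

theorem indep_noiseSigma {B B' : Set (V × ℤ)} (h : Disjoint B B') :
    Indep (M.noiseSigma B) (M.noiseSigma B') M.μ :=
  indep_iSup_of_disjoint M.comap_noise_le M.indep_noise h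

theorem measurable_noise_noiseSigma {B : Set (V × ℤ)} {u : V × ℤ} (hu : u ∈ B) :
    Measurable[M.noiseSigma B] (M.noise u) :=
  (comap_measurable (M.noise u)).mono (le_iSup₂ (f := fun b (_ : b ∈ B) =>
    MeasurableSpace.comap (M.noise b) (M.measurableSpaceNoise b.1)) u hu) le_rfl

theorem measurable_trajectory : Measurable fun ω u => M.val u ω :=
  measurable_pi_lambda _ fun u => (M.measurable_val u).mono (M.noiseSigma_le _) le_rfl

theorem measurable_mechanism {B : Set (V × ℤ)} {g : M.Ω → Trajectory S} {u : V × ℤ} (hu : u ∈ B)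
    (hg : ∀ p, F.Adj p u → Measurable[M.noiseSigma B] fun ω => g ω p) :
    Measurable[M.noiseSigma B] fun ω => M.mechanism (g ω) ω u := by
  let := M.noiseSigma B
  have hparents : Measurable[M.noiseSigma B] fun ω (p : F.Pa u.1) => g ω (p.1.1, u.2 - p.1.2) :=
    measurable_pi_lambda _ fun p => hg _ (F.adj_of_lagAdj p.2 u.2)
  exact (M.measurable_f u.1).comp (hparents.prodMk (M.measurable_noise_noiseSigma hu))

variable [Finite V] {I B : Set (V × ℤ)} (h : Trajectory S) {s : ℤ}

theorem measurable_fixedVal (hI : ∀ v ∈ I, s ≤ v.2)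
    (hB : ParentClosed (removeOutgoing F.toDigraph I) B) {u : V × ℤ} (hu : u ∈ I ∪ B) :
    Measurable[M.noiseSigma B] fun ω => M.fixedVal I h s ω u := by
  induction u using F.induction_from s with
  | base u hus =>
    have huB : u ∈ B := hu.resolve_left fun huI => (hI u huI).not_gt hus
    simp only [M.fixedVal_of_lt h hI hus]
    exact (M.measurable_val u).mono
      (biSup_mono fun _ => F.mem_of_isDescendant_of_lt hI hB huB hus) le_rfl
  | step u _ ih =>
    by_cases huI : u ∈ I
    · simp only [M.fixedVal_of_mem h huI]
      exact @measurable_const _ _ _ (M.noiseSigma B) _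
    · have huB : u ∈ B := hu.resolve_left huI
      simp only [M.solvesOff_fixedVal h hI u huI]
      exact M.measurable_mechanism huB fun p hpu =>
        ih p hpu (or_iff_not_imp_left.2 fun hpI => hB ⟨hpu, hpI⟩ huB)

/-- The event that, while the variables in `I` are held fixed at their values in `h`, the
structural equations of the variables in `J` give these the values that they have in `h`. -/
def mechanismEvent (I : Set (V × ℤ)) (s : ℤ) (J : Set (V × ℤ)) : Set M.Ω :=
  {ω | ∀ v ∈ J, M.mechanism (M.fixedVal I h s ω) ω v = h v}

theorem mechanismEvent_anti {J K : Set (V × ℤ)} (hJK : J ⊆ K) :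
    M.mechanismEvent h I s K ⊆ M.mechanismEvent h I s J :=
  fun _ hω v hv => hω v (hJK hv)

theorem mechanismEvent_union (J K : Set (V × ℤ)) :
    M.mechanismEvent h I s (J ∪ K) = M.mechanismEvent h I s J ∩ M.mechanismEvent h I s K :=
  Set.ext fun _ => ⟨fun hω => ⟨fun v hv => hω v (.inl hv), fun v hv => hω v (.inr hv)⟩,
    fun hω v hv => hv.elim (hω.1 v) (hω.2 v)⟩

theorem setOf_val_eq_mechanismEvent (hI : ∀ v ∈ I, s ≤ v.2) :
    {ω | ∀ v ∈ I, M.val v ω = h v} = M.mechanismEvent h I s I := by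
  ext ω
  have key := (M.solvesOff_val ω ∅).forall_eq_iff (h := h) (Set.empty_subset I) (by simp)
    (fun _ _ => rfl) hI
  rwa [Set.sdiff_empty] at key

variable {x₀ y₀ : V × ℤ} {Z : Set (V × ℤ)}

theorem forall_doVal_eq_iff (hdesc : ∀ z ∈ Z, ¬ F.IsDescendant x₀ z) {ω : M.Ω} :
    (∀ v ∈ insert x₀ Z, M.doVal x₀ (h x₀) ω v = h v) ↔ ∀ v ∈ Z, M.val v ω = h v := by
  rw [Set.forall_mem_insert, M.doVal_self]
  simp only [true_and]
  exact forall₂_congr fun v hv => by rw [M.doVal_of_not_isDescendant x₀ _ ω (hdesc v hv)]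

theorem setOf_val_eq_mechanismEvent_insert (hI : ∀ v ∈ insert x₀ Z, s ≤ v.2)
    (hdesc : ∀ z ∈ Z, ¬ F.IsDescendant x₀ z) :
    {ω | ∀ v ∈ Z, M.val v ω = h v} = M.mechanismEvent h (insert x₀ Z) s Z := by
  have hx₀Z : x₀ ∉ Z := fun hx₀ => hdesc x₀ hx₀ .refl
  ext ω
  have key := (M.solvesOff_doVal x₀ (h x₀) ω).forall_eq_iff (h := h) (I := insert x₀ Z) (s := s)
    (by simp) (by simp [M.doVal_self])
    (fun u hu => M.doVal_of_lt _ _ _ (hu.trans_le (hI x₀ (Set.mem_insert _ _)))) hI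
  rw [M.forall_doVal_eq_iff h hdesc, Set.insert_sdiff_self_of_notMem hx₀Z] at key
  exact key

theorem doVal_eq_fixedVal (hI : ∀ v ∈ insert x₀ Z, s ≤ v.2)
    (hdesc : ∀ z ∈ Z, ¬ F.IsDescendant x₀ z) {ω : M.Ω} (hω : ∀ v ∈ Z, M.val v ω = h v) :
    M.doVal x₀ (h x₀) ω = M.fixedVal (insert x₀ Z) h s ω :=
  ((M.solvesOff_doVal x₀ (h x₀) ω).mono (by simp)).eq_fixedVal
    ((M.forall_doVal_eq_iff h hdesc).2 hω)
    (fun u hu => M.doVal_of_lt _ _ _ (hu.trans_le (hI x₀ (Set.mem_insert _ _)))) hI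

variable [∀ X, MeasurableSingletonClass (S X)]

theorem measurableSet_mechanismEvent (hI : ∀ v ∈ I, s ≤ v.2)
    (hB : ParentClosed (removeOutgoing F.toDigraph I) B) {J : Set (V × ℤ)} (hJ : J.Finite)
    (hJB : J ⊆ B) : MeasurableSet[M.noiseSigma B] (M.mechanismEvent h I s J) := by
  let := M.noiseSigma B
  simp only [mechanismEvent, Set.ofPred_forall]
  refine hJ.measurableSet_biInter fun v hv => ?_
  exact M.measurable_mechanism (hJB hv) (fun p hpv => M.measurable_fixedVal h hI hB
    (or_iff_not_imp_left.2 fun hpI => hB ⟨hpv, hpI⟩ (hJB hv))) (measurableSet_singleton (h v))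

theorem cond_mechanismEvent {B₁ B₂ J : Set (V × ℤ)} {D : Set M.Ω} (hI : ∀ v ∈ I, s ≤ v.2)
    (hB : Disjoint B₁ B₂) (hB₁ : ParentClosed (removeOutgoing F.toDigraph I) B₁)
    (hB₂ : ParentClosed (removeOutgoing F.toDigraph I) B₂) (hJ : J.Finite) (hJB : J ⊆ B₁ ∪ B₂)
    (hD : MeasurableSet[M.noiseSigma B₂] D) (hJ0 : M.μ (M.mechanismEvent h I s J) ≠ 0) :
    M.μ[D | M.mechanismEvent h I s J] = M.μ[D | M.mechanismEvent h I s (J ∩ B₂)] := by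
  have hsplit : M.mechanismEvent h I s J =
      M.mechanismEvent h I s (J ∩ B₁) ∩ M.mechanismEvent h I s (J ∩ B₂) := by
    rw [← mechanismEvent_union, ← Set.inter_union_distrib_left, Set.inter_eq_left.2 hJB]
  rw [hsplit]
  exact cond_inter_eq_cond_of_indep (M.noiseSigma_le B₁) (M.noiseSigma_le B₂)
    (M.indep_noiseSigma hB)
    (M.measurableSet_mechanismEvent h hI hB₁ (hJ.inter_of_left B₁) Set.inter_subset_right)
    (M.measurableSet_mechanismEvent h hI hB₂ (hJ.inter_of_left B₂) Set.inter_subset_right) hD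
    (measure_pos_of_superset (M.mechanismEvent_anti h Set.inter_subset_left) hJ0).ne'

theorem cond_val_insert_eq_cond_val (hZ : Z.Finite) (hne : x₀ ≠ y₀)
    (hblock : ∀ π, F.IsBackdoorPath π x₀ y₀ → F.Blocks Z π x₀ y₀)
    (hdesc : ∀ z ∈ Z, ¬ F.IsDescendant x₀ z)
    (hpos : M.μ {ω | ∀ v ∈ insert x₀ Z, M.val v ω = h v} ≠ 0) (b : S y₀.1) :
    M.μ[{ω | M.doVal x₀ (h x₀) ω y₀ = b} | {ω | ∀ v ∈ insert x₀ Z, M.val v ω = h v}] =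
      M.μ[{ω | M.doVal x₀ (h x₀) ω y₀ = b} | {ω | ∀ v ∈ Z, M.val v ω = h v}] := by
  have hx₀Z : x₀ ∉ Z := fun hx₀ => hdesc x₀ hx₀ .refl
  obtain ⟨s, hs⟩ : ∃ s, ∀ v ∈ insert x₀ Z, s ≤ v.2 :=
    let ⟨s, hs⟩ := ((hZ.insert x₀).image Prod.snd).bddBelow
    ⟨s, fun v hv => hs ⟨v, hv, rfl⟩⟩
  obtain ⟨B₁, B₂, hB, hB₁, hB₂, hx₀, hy₀, hZB⟩ := exists_parentClosed_separation hne hx₀Z hblock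
  set D := {ω | M.fixedVal (insert x₀ Z) h s ω y₀ = b}
  have hD : MeasurableSet[M.noiseSigma B₂] D :=
    M.measurable_fixedVal h hs hB₂ (hy₀.imp_left (Set.mem_insert_of_mem x₀))
      (measurableSet_singleton b)
  have hdo {J : Set (V × ℤ)} (hJ : J.Finite) (hZJ : Z ⊆ J) :
      M.μ[{ω | M.doVal x₀ (h x₀) ω y₀ = b} | {ω | ∀ v ∈ J, M.val v ω = h v}] =
        M.μ[D | {ω | ∀ v ∈ J, M.val v ω = h v}] :=
    cond_congr_of_forall_mem (M.measurable_trajectory (measurableSet_forall_eq hJ h))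
      fun ω hω => by
        rw [Set.mem_ofPred_eq, M.doVal_eq_fixedVal h hs hdesc fun v hv => hω v (hZJ hv)]
        rfl
  have hpos' : M.μ {ω | ∀ v ∈ Z, M.val v ω = h v} ≠ 0 :=
    fun hnull => hpos <| measure_mono_null
      (fun ω hω v hv => hω v (Set.mem_insert_of_mem x₀ hv)) hnull
  rw [hdo (hZ.insert x₀) (Set.subset_insert x₀ Z), hdo hZ .rfl]
  rw [M.setOf_val_eq_mechanismEvent h hs] at hpos ⊢
  rw [M.setOf_val_eq_mechanismEvent_insert h hs hdesc] at hpos' ⊢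
  rw [M.cond_mechanismEvent h hs hB hB₁ hB₂ (hZ.insert x₀)
      (Set.insert_subset (.inl hx₀) hZB) hD hpos,
    M.cond_mechanismEvent h hs hB hB₁ hB₂ hZ hZB hD hpos',
    Set.insert_inter_of_notMem (Set.disjoint_left.1 hB hx₀)]

end DSCM

/-! ### Adjustment -/

section Adjustment

variable {V : Type*} {γmax : ℕ} {S : V → Type*} [∀ X, MeasurableSpace (S X)] {F : FTCG V γmax}

/-- Overlap at the value `a` of `x₀`: it has positive probability together with any values of `Z`
that have positive probability. For an adjustment for `Z` under `do(x₀ = a)` only this part of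
positivity matters; where it fails, the conditional probabilities in `adjustment` are zero by
convention. -/
def HasOverlap (P : Measure (Trajectory S)) (x₀ : V × ℤ) (a : S x₀.1) (Z : Finset (V × ℤ)) :
    Prop :=
  ∀ z : (∀ u : Z, S u.1.1), P {h | ∀ u : Z, h u.1 = z u} ≠ 0 →
    P {h | h x₀ = a ∧ ∀ u : Z, h u.1 = z u} ≠ 0

theorem IsPositiveLaw.hasOverlap {P : Measure (Trajectory S)} (hP : IsPositiveLaw P) {x₀ : V × ℤ}
    {Z : Finset (V × ℤ)} (hx₀ : x₀ ∉ Z) (a : S x₀.1) : HasOverlap P x₀ a Z := by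
  classical
  intro z hz
  obtain ⟨g, hg⟩ := nonempty_of_measure_ne_zero hz
  refine (measure_pos_of_superset (fun h hh => ?_)
    (hP (insert x₀ Z) (Function.update g x₀ a)).ne').ne'
  refine ⟨by simpa using hh x₀ (Finset.mem_insert_self x₀ Z), fun u => ?_⟩
  have hu : u.1 ≠ x₀ := fun hux => hx₀ (hux ▸ u.2)
  rw [hh u (Finset.mem_insert_of_mem u.2), Function.update_of_ne hu, hg u]

variable [Finite V] [∀ X, MeasurableSingletonClass (S X)] (M : DSCM S F) {x₀ y₀ : V × ℤ}

theorem DSCM.law_cond_mul_law_eq {Z : Set (V × ℤ)} (h : Trajectory S) (hZ : Z.Finite)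
    (hne : x₀ ≠ y₀) (hblock : ∀ π, F.IsBackdoorPath π x₀ y₀ → F.Blocks Z π x₀ y₀)
    (hdesc : ∀ z ∈ Z, ¬ F.IsDescendant x₀ z)
    (hpos : M.law {g | ∀ u ∈ insert x₀ Z, g u = h u} ≠ 0) (b : S y₀.1) :
    M.law[{g | g y₀ = b} | {g | ∀ u ∈ insert x₀ Z, g u = h u}] *
        M.law {g | ∀ u ∈ Z, g u = h u} =
      M.μ ({ω | ∀ u ∈ Z, M.val u ω = h u} ∩ {ω | M.doVal x₀ (h x₀) ω y₀ = b}) := by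
  have hT := M.measurable_trajectory
  have hmeasZ := measurableSet_forall_eq hZ h
  have hmeasxZ := measurableSet_forall_eq (hZ.insert x₀) h
  have hmeasy : MeasurableSet {g : Trajectory S | g y₀ = b} :=
    (measurable_pi_apply y₀ : Measurable fun g : Trajectory S => g y₀) (measurableSet_singleton b)
  have hconsistent : M.μ[{ω | M.val y₀ ω = b} | {ω | ∀ u ∈ insert x₀ Z, M.val u ω = h u}] =
      M.μ[{ω | M.doVal x₀ (h x₀) ω y₀ = b} | {ω | ∀ u ∈ insert x₀ Z, M.val u ω = h u}] :=
    cond_congr_of_forall_mem (hT hmeasxZ) fun ω hω => by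
      rw [Set.mem_ofPred_eq, Set.mem_ofPred_eq, M.doVal_of_val_eq (hω x₀ (Set.mem_insert x₀ Z))]
  rw [DSCM.law, Measure.map_apply hT hmeasxZ] at hpos
  rw [DSCM.law, cond_map_apply hT hmeasxZ hmeasy, Measure.map_apply hT hmeasZ]
  exact (congrArg (· * _) (hconsistent.trans
    (M.cond_val_insert_eq_cond_val h hZ hne hblock hdesc hpos b))).trans
    (cond_mul_eq_inter (hT hmeasZ) _ M.μ)

theorem mainTheorem5_general {Z : Finset (V × ℤ)} [∀ u : Z, Countable (S u.1.1)] (hne : x₀ ≠ y₀)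
    (hblock : ∀ π, F.IsBackdoorPath π x₀ y₀ → F.Blocks (Z : Set (V × ℤ)) π x₀ y₀)
    (hdesc : ∀ z ∈ Z, ¬ F.IsDescendant x₀ z) {a : S x₀.1}
    (hoverlap : HasOverlap M.law x₀ a Z) (b : S y₀.1) :
    M.totalEffect x₀ y₀ a b = adjustment M.law x₀ y₀ Z a b := by
  have hvalZ : Measurable fun ω (u : Z) => M.val u.1 ω :=
    measurable_pi_lambda _ fun u => measurable_pi_iff.1 M.measurable_trajectory u.1
  rw [DSCM.totalEffect, ← tsum_measure_preimage_singleton_inter M.μ hvalZ, adjustment]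
  refine tsum_congr fun z => ?_
  have hpre : (fun ω (u : Z) => M.val u.1 ω) ⁻¹' {z} = {ω | ∀ u : Z, M.val u.1 ω = z u} :=
    Set.ext fun ω => funext_iff
  by_cases hz : M.law {g | ∀ u : Z, g u.1 = z u} = 0
  · have hnull : M.μ ((fun ω (u : Z) => M.val u.1 ω) ⁻¹' {z}) = 0 := by
      rw [hpre]
      exact Measure.preimage_null_of_map_null M.measurable_trajectory.aemeasurable hz
    rw [hz, mul_zero, measure_mono_null Set.inter_subset_left hnull]
  · obtain ⟨g, hga, hgz⟩ := nonempty_of_measure_ne_zero (hoverlap z hz)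
    obtain rfl : g x₀ = a := hga
    obtain rfl : (fun u : Z => g u.1) = z := funext hgz
    have hpos := hoverlap _ hz
    have key := M.law_cond_mul_law_eq g Z.finite_toSet hne hblock hdesc (b := b)
    simp only [Set.forall_mem_insert, SetLike.mem_coe, Subtype.forall] at key hpos hpre ⊢
    rw [key hpos, hpre]

end Adjustment

theorem mainTheorem5 {V : Type*} [Finite V]
    (S : V → Type*) [∀ X, MeasurableSpace (S X)] [∀ X, Countable (S X)]
    [∀ X, MeasurableSingletonClass (S X)]
    (γmax : ℕ) (G : CausalAbstraction V)
    (F : FTCG V γmax) (hF : F ∈ G.candidates γmax)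
    (M : DSCM.{w} S F) (hM : IsPositiveLaw M.law)
    (X Y : V) (γ : ℕ) (hXY : X ≠ Y ∨ γ ≠ 0) (t : ℤ) (Z : Finset (V × ℤ))
    (hZ : G.SatisfiesBackdoor γmax (X, t - γ) (Y, t) (Z : Set (V × ℤ))) :
    Identifiable.{w} γmax S G (X, t - γ) (Y, t) ∧
      ∀ (x : S X) (y : S Y),
        M.totalEffect (X, t - γ) (Y, t) x y = adjustment M.law (X, t - γ) (Y, t) Z x y := by
  have hne : ((X, t - γ) : V × ℤ) ≠ (Y, t) := fun h => by
    obtain ⟨rfl, hγ⟩ := Prod.mk.inj h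
    exact hXY.elim (· rfl) fun hγ0 => by omega
  have hadjust (F' : FTCG V γmax) (hF' : F' ∈ G.candidates γmax) (M' : DSCM.{w} S F')
      (hM' : IsPositiveLaw M'.law) (x : S X) (y : S Y) :
      M'.totalEffect (X, t - γ) (Y, t) x y = adjustment M'.law (X, t - γ) (Y, t) Z x y :=
    let ⟨hblock, hdesc⟩ := hZ F' hF'
    mainTheorem5_general M' hne hblock hdesc (hM'.hasOverlap (fun hx => hdesc _ hx .refl) x) y
  exact ⟨⟨fun P x y => adjustment P (X, t - γ) (Y, t) Z x y, hadjust⟩, hadjust F hF M hM⟩
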